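/- An access point multicasts $k$ input packets to three clients. Each transmission $t=0,1,2,\dots$ carries one codeword, a linear combination of the $k$ packets over $GF(2)$ given by a coding vector in $GF(2)^k$. Each client receives each transmission with probability $s=1-p$, where $0\le p<1$, independently over clients and transmissions. The access point knows which codewords each client has received: a policy chooses each coding vector as a function of the reception outcomes of all earlier transmissions. Let $t_x$ be the number of transmissions until each of the three clients has received $k$ linearly independent codewords, and let $E[t_x]$ denote the minimum (infimum) of its expected value over all policies. Call a policy greedy if it always sends a codeword which is linearly independent of the received codewords for the largest possible number of clients. Let $\ell$ be the number of transmissions until the first two clients have each received at least $k$ codewords and the third client has received at least $k+1$ codewords, and put $$D_1(m)=\sum_{j=k}^m\binom mj s^jp^{m-j},\qquad D_2(m)=\sum_{j=k+1}^m\binom mj s^jp^{m-j}.$$ Then, for every $k$, $$E[t_x]\le E[\ell]=\sum_{m=0}^\infty\bigl(1-D_1(m)^2D_2(m)\bigr)=k+1+\sum_{m=k+1}^\infty\bigl(1-D_1(m)^2D_2(m)\bigr)<\infty ,$$ and, moreover, the expected value of $t_x$ under every greedy policy is at most $E[\ell]$. -/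

import Mathlib

open MeasureTheory ProbabilityTheory
open scoped ENNReal

noncomputable section

namespace Multicast

/-- The outcome of one transmission to the three clients: `o i = true` iff client `i` receives it. -/
abbrev Outcome := Fin 3 → Bool

/-- Coding vectors over `GF(2)` for `k` input packets; a codeword is identified with its vector. -/
abbrev CodingVector (k : ℕ) := Fin k → ZMod 2

/-- A transmission policy of the access point, which has full feedback: the next coding vector is a
function of the outcomes of all earlier transmissions (a list, most recent outcome first). Since the
access point also knows what it sent before, this is knowledge of all that each client has received. -/
abbrev Policy (k : ℕ) := List Outcome → CodingVector k

/-- The set `Y_i` of (coding vectors of) the codewords client `i` has received after a history. -/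
def received {k : ℕ} (π : Policy k) (i : Fin 3) : List Outcome → Set (CodingVector k)
  | [] => ∅
  | o :: h => if o i = true then insert (π h) (received π i h) else received π i h

/-- The rank `r_i`: the number of linearly independent codewords held by client `i`. -/
def rank {k : ℕ} (π : Policy k) (i : Fin 3) (h : List Outcome) : ℕ :=
  Module.finrank (ZMod 2) (Submodule.span (ZMod 2) (received π i h))

/-- Every client holds `k` linearly independent codewords. -/
def AllSatisfied {k : ℕ} (π : Policy k) (h : List Outcome) : Prop :=
  ∀ i, rank π i h = k

/-- The clients for which the coding vector `w` is linearly independent of what they hold. A client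
of rank `k` never belongs to this set. -/
def innovativeFor {k : ℕ} (π : Policy k) (h : List Outcome) (w : CodingVector k) : Set (Fin 3) :=
  {i | w ∉ Submodule.span (ZMod 2) (received π i h)}

/-- The policy always sends a codeword that is linearly independent for the maximum number of
clients. -/
def IsGreedy {k : ℕ} (π : Policy k) : Prop :=
  ∀ (h : List Outcome) (w : CodingVector k),
    (innovativeFor π h w).ncard ≤ (innovativeFor π h (π h)).ncard

/-- The outcomes of the first `m` transmissions, most recent first. -/
def history (r : ℕ → Outcome) : ℕ → List Outcome
  | 0 => []
  | m + 1 => r m :: history r m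

/-- `t_x`: the number of transmissions until all three clients hold `k` linearly independent
codewords (`∞` if that never happens). -/
def completionTime {k : ℕ} (π : Policy k) (r : ℕ → Outcome) : ℝ≥0∞ :=
  ⨅ (m : ℕ) (_ : AllSatisfied π (history r m)), (m : ℝ≥0∞)

/-- How many of the first `m` transmissions client `i` receives. -/
def receptions (r : ℕ → Outcome) (i : Fin 3) (m : ℕ) : ℕ :=
  ((Finset.range m).filter fun t => r t i = true).card

/-- `ℓ`: the number of transmissions until two clients have received at least `k` codewords and the
other one at least `k + 1` (`∞` if that never happens). -/
def ell (k : ℕ) (r : ℕ → Outcome) : ℝ≥0∞ :=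
  ⨅ (m : ℕ) (_ : k ≤ receptions r 0 m ∧ k ≤ receptions r 1 m ∧ k + 1 ≤ receptions r 2 m),
    (m : ℝ≥0∞)

/-- The expected number of transmissions under the policy `π`, when `R t i` tells whether client `i`
receives transmission `t`. -/
def expectedTime {Ω : Type*} [MeasurableSpace Ω] (μ : Measure Ω) (R : ℕ → Fin 3 → Ω → Bool)
    {k : ℕ} (π : Policy k) : ℝ≥0∞ :=
  ∫⁻ ω, completionTime π (fun t i => R t i ω) ∂μ

/-- The minimum expected number of transmissions, over all policies. -/
def minExpectedTime {Ω : Type*} [MeasurableSpace Ω] (μ : Measure Ω) (R : ℕ → Fin 3 → Ω → Bool)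
    (k : ℕ) : ℝ≥0∞ :=
  ⨅ π : Policy k, expectedTime μ R π

/-- `E[ℓ]`. -/
def expectedEll {Ω : Type*} [MeasurableSpace Ω] (μ : Measure Ω) (R : ℕ → Fin 3 → Ω → Bool)
    (k : ℕ) : ℝ≥0∞ :=
  ∫⁻ ω, ell k (fun t i => R t i ω) ∂μ

/-- `D₁(m)`: the probability of at least `k` successes in `m` trials with failure probability `p`. -/
def D₁ (k : ℕ) (p : ℝ) (m : ℕ) : ℝ :=
  ∑ j ∈ Finset.Icc k m, (m.choose j : ℝ) * (1 - p) ^ j * p ^ (m - j)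

/-- `D₂(m)`: the probability of at least `k + 1` successes in `m` trials with failure probability
`p`. -/
def D₂ (k : ℕ) (p : ℝ) (m : ℕ) : ℝ :=
  ∑ j ∈ Finset.Icc (k + 1) m, (m.choose j : ℝ) * (1 - p) ^ j * p ^ (m - j)

end Multicast

end

noncomputable section

namespace Multicast

/-! ### Binomial tails -/

/-! Two proper subspaces never cover a vector space, but over `GF(2)` three can, and then each has
codimension one (`finrank_eq_of_cover`). So a greedy codeword is innovative for every unsatisfied
client except in the stuck state, where each client lacks exactly one dimension and every codeword
is useless to somebody. There a greedy codeword still serves exactly two clients. As soon as one of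
those two receives it, that client is satisfied, and no stuck state can occur again.

Outside the stuck state every reception counts, so the deficits evolve like plain reception demands,
whose expected waiting time is `waitTime`. The expected time left from the stuck state is explicit,
and it is at most the waiting time for demands 1, 1, 2 (`stuckTime_le_waitTime`). One extra
reception charged to the third client therefore pays for getting stuck.

This charge is built into `potential`, which falls in expectation by at least one per transmission
until completion (`potential_drift`). Summing over time bounds the mean completion time by the
initial potential, hence by the waiting time for demands k, k, k + 1. Independence identifies that
waiting time with E[ℓ], as the tail sum of a product of binomial tails. -/

theorem D₂_eq_D₁ (k : ℕ) (p : ℝ) (m : ℕ) : D₂ k p m = D₁ (k + 1) p m := rfl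

theorem D₁_eq_zero {a m : ℕ} (h : m < a) (p : ℝ) : D₁ a p m = 0 := by
  simp [D₁, Finset.Icc_eq_empty_of_lt h]

theorem D₁_zero (p : ℝ) (m : ℕ) : D₁ 0 p m = 1 := by
  have h := add_pow (1 - p) p m
  rw [sub_add_cancel, one_pow] at h
  rw [h, D₁, Finset.range_eq_Ico]
  refine Finset.sum_congr (by ext; simp) fun j _ => by ring

/-- Condition on one trial; on coefficients this is Pascal's rule. -/
theorem D₁_succ_succ (a : ℕ) (p : ℝ) (m : ℕ) :
    D₁ (a + 1) p (m + 1) = (1 - p) * D₁ a p m + p * D₁ (a + 1) p m := by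
  have h1 : D₁ (a + 1) p (m + 1) = ∑ i ∈ Finset.Icc a m,
      ((m + 1).choose (i + 1) : ℝ) * (1 - p) ^ (i + 1) * p ^ (m - i) := by
    rw [D₁, ← Finset.map_add_right_Icc a m 1, Finset.sum_map]
    simp
  have h2 : D₁ (a + 1) p m = ∑ i ∈ Finset.Icc (a + 1) (m + 1),
      (m.choose i : ℝ) * (1 - p) ^ i * p ^ (m - i) := by
    rw [D₁]
    refine Finset.sum_subset (Finset.Icc_subset_Icc_right (Nat.le_succ m)) fun i hi hi' => ?_
    rw [Finset.mem_Icc] at hi hi'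
    rw [Nat.choose_eq_zero_of_lt (by omega)]
    simp
  rw [h1, h2, D₁, ← Finset.map_add_right_Icc a m 1, Finset.sum_map, Finset.mul_sum,
    Finset.mul_sum, ← Finset.sum_add_distrib]
  refine Finset.sum_congr rfl fun i hi => ?_
  rw [Finset.mem_Icc] at hi
  simp only [addRightEmbedding_apply, Nat.choose_succ_succ]
  rcases hi.2.eq_or_lt with rfl | hlt
  · simp; ring
  · obtain ⟨d, rfl⟩ := Nat.exists_eq_add_of_lt hlt
    have e1 : i + d + 1 - i = d + 1 := by omega
    have e2 : i + d + 1 - (i + 1) = d := by omega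
    rw [e1, e2]
    push_cast
    ring

theorem D₁_succ (a : ℕ) (p : ℝ) (m : ℕ) :
    D₁ a p (m + 1) = (1 - p) * D₁ (a - 1) p m + p * D₁ a p m := by
  cases a with
  | zero => simp [D₁_zero]
  | succ a => simpa using D₁_succ_succ a p m

section Bounds

variable {p : ℝ}

theorem D₁_nonneg (hp0 : 0 ≤ p) (hp1 : p ≤ 1) (a m : ℕ) : 0 ≤ D₁ a p m :=
  Finset.sum_nonneg fun _ _ => mul_nonneg
    (mul_nonneg (Nat.cast_nonneg _) (pow_nonneg (sub_nonneg.2 hp1) _)) (pow_nonneg hp0 _)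

theorem D₁_antitone (hp0 : 0 ≤ p) (hp1 : p ≤ 1) {a b : ℕ} (hab : a ≤ b) (m : ℕ) :
    D₁ b p m ≤ D₁ a p m :=
  Finset.sum_le_sum_of_subset_of_nonneg (Finset.Icc_subset_Icc_left hab) fun _ _ _ => mul_nonneg
    (mul_nonneg (Nat.cast_nonneg _) (pow_nonneg (sub_nonneg.2 hp1) _)) (pow_nonneg hp0 _)

theorem D₁_le_one (hp0 : 0 ≤ p) (hp1 : p ≤ 1) (a m : ℕ) : D₁ a p m ≤ 1 :=
  (D₁_antitone hp0 hp1 a.zero_le m).trans (D₁_zero p m).le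

theorem summable_one_sub_D₁ (hp0 : 0 ≤ p) (hp1 : p < 1) (a : ℕ) :
    Summable fun m => 1 - D₁ a p m := by
  induction a with
  | zero => simp [D₁_zero]
  | succ a ih =>
    have hs : 0 < 1 - p := sub_pos.2 hp1
    -- With Q the sum for `a`, the partial sums satisfy S(n+1) ≤ 1 + (1 - p) Q + p S(n). The
    -- constant 1 / (1 - p) + Q is the fixed point of this recursion.
    refine summable_of_sum_range_le (c := 1 / (1 - p) + ∑' m, (1 - D₁ a p m))
      (fun m => sub_nonneg.2 (D₁_le_one hp0 hp1.le _ m)) fun n => ?_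
    have hQ : 0 ≤ ∑' m, (1 - D₁ a p m) :=
      tsum_nonneg fun m => sub_nonneg.2 (D₁_le_one hp0 hp1.le _ m)
    induction n with
    | zero => simpa using add_nonneg (inv_nonneg.2 hs.le) hQ
    | succ n ihn =>
      have hle := ih.sum_le_tsum (Finset.range n)
        fun m _ => sub_nonneg.2 (D₁_le_one hp0 hp1.le a m)
      have hrec : ∑ m ∈ Finset.range n, (1 - D₁ (a + 1) p (m + 1)) =
          (1 - p) * ∑ m ∈ Finset.range n, (1 - D₁ a p m) +
            p * ∑ m ∈ Finset.range n, (1 - D₁ (a + 1) p m) := by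
        rw [Finset.mul_sum, Finset.mul_sum, ← Finset.sum_add_distrib]
        refine Finset.sum_congr rfl fun m _ => ?_
        rw [D₁_succ_succ]; ring
      rw [Finset.sum_range_succ', hrec, D₁_eq_zero a.succ_pos]
      have e : 1 / (1 - p) = 1 + p * (1 / (1 - p)) := by field_simp; ring
      nlinarith [mul_le_mul_of_nonneg_left hle hs.le, mul_le_mul_of_nonneg_left ihn hp0]

end Bounds

/-! ### Waiting for prescribed numbers of receptions -/

/-- The probability of the outcome `o` of one transmission with erasure probability `p`. -/
def outcomeProb (p : ℝ) (o : Outcome) : ℝ := ∏ i, if o i = true then 1 - p else p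

/-- What is left of the demands `a` after the outcome `o`. -/
def serve (a : Fin 3 → ℕ) (o : Outcome) : Fin 3 → ℕ := fun i => a i - (o i).toNat

/-- The probability that every client `i` receives at least `a i` of `m` transmissions. -/
def servedProb (p : ℝ) (a : Fin 3 → ℕ) (m : ℕ) : ℝ := ∏ i, D₁ (a i) p m

/-- The expected number of transmissions until every client `i` has received `a i` of them. -/
def waitTime (p : ℝ) (a : Fin 3 → ℕ) : ℝ := ∑' m, (1 - servedProb p a m)

theorem sum_outcome {M : Type*} [AddCommMonoid M] (f : Outcome → M) :
    ∑ o, f o = ∑ a : Bool, ∑ b : Bool, ∑ c : Bool, f ![a, b, c] := by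
  rw [← (Fin.consEquiv fun _ => Bool).sum_comp, Fintype.sum_prod_type]
  refine Finset.sum_congr rfl fun a _ => ?_
  rw [← (Fin.consEquiv fun _ => Bool).sum_comp, Fintype.sum_prod_type]
  refine Finset.sum_congr rfl fun b _ => ?_
  rw [← (Equiv.funUnique (Fin 1) Bool).symm.sum_comp]
  refine Finset.sum_congr rfl fun c _ => ?_
  congr 1
  ext i
  fin_cases i <;> rfl

theorem sum_outcomeProb_mul_prod (p : ℝ) (f : Fin 3 → Bool → ℝ) :
    ∑ o, outcomeProb p o * ∏ i, f i (o i) = ∏ i, ((1 - p) * f i true + p * f i false) := by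
  simp only [sum_outcome, outcomeProb, Fin.prod_univ_three, Fintype.sum_bool]
  simp
  ring

theorem sum_outcomeProb (p : ℝ) : ∑ o, outcomeProb p o = 1 := by
  simpa using sum_outcomeProb_mul_prod p fun _ _ => 1

theorem servedProb_succ (p : ℝ) (a : Fin 3 → ℕ) (m : ℕ) :
    servedProb p a (m + 1) = ∑ o, outcomeProb p o * servedProb p (serve a o) m := by
  simp only [servedProb, serve, D₁_succ]
  rw [sum_outcomeProb_mul_prod p fun i b => D₁ (a i - b.toNat) p m]
  simp

theorem servedProb_zero (p : ℝ) (a : Fin 3 → ℕ) :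
    servedProb p a 0 = if a = 0 then 1 else 0 := by
  split_ifs with h
  · simp [h, servedProb, D₁_zero]
  · obtain ⟨i, hi⟩ := Function.ne_iff.1 h
    exact Finset.prod_eq_zero (Finset.mem_univ i) (D₁_eq_zero (Nat.pos_of_ne_zero hi) p)

section Wait

variable {p : ℝ}

theorem outcomeProb_nonneg (hp0 : 0 ≤ p) (hp1 : p ≤ 1) (o : Outcome) : 0 ≤ outcomeProb p o :=
  Finset.prod_nonneg fun _ _ => by split_ifs <;> linarith

theorem servedProb_le_one (hp0 : 0 ≤ p) (hp1 : p ≤ 1) (a : Fin 3 → ℕ) (m : ℕ) :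
    servedProb p a m ≤ 1 :=
  Finset.prod_le_one (fun _ _ => D₁_nonneg hp0 hp1 _ _) fun _ _ => D₁_le_one hp0 hp1 _ _

theorem servedProb_antitone (hp0 : 0 ≤ p) (hp1 : p ≤ 1) {a b : Fin 3 → ℕ} (hab : a ≤ b) (m : ℕ) :
    servedProb p b m ≤ servedProb p a m :=
  Finset.prod_le_prod (fun _ _ => D₁_nonneg hp0 hp1 _ _)
    fun i _ => D₁_antitone hp0 hp1 (hab i) m

theorem summable_one_sub_servedProb (hp0 : 0 ≤ p) (hp1 : p < 1) (a : Fin 3 → ℕ) :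
    Summable fun m => 1 - servedProb p a m := by
  refine Summable.of_nonneg_of_le
    (fun m => sub_nonneg.2 (servedProb_le_one hp0 hp1.le a m)) (fun m => ?_)
    (((summable_one_sub_D₁ hp0 hp1 (a 0)).add (summable_one_sub_D₁ hp0 hp1 (a 1))).add
      (summable_one_sub_D₁ hp0 hp1 (a 2)))
  have h i := D₁_nonneg hp0 hp1.le (a i) m
  have h' i := D₁_le_one hp0 hp1.le (a i) m
  simp only [servedProb, Fin.prod_univ_three]
  -- The union bound 1 - xyz ≤ (1 - x) + (1 - y) + (1 - z) on the unit cube.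
  nlinarith [mul_nonneg (sub_nonneg.2 (h' 0)) (sub_nonneg.2 (h' 1)), mul_nonneg (h 0) (h 1),
    mul_nonneg (sub_nonneg.2 (h' 2))
      (sub_nonneg.2 (mul_le_one₀ (h' 0) (h 1) (h' 1)))]

theorem waitTime_nonneg (hp0 : 0 ≤ p) (hp1 : p ≤ 1) (a : Fin 3 → ℕ) : 0 ≤ waitTime p a :=
  tsum_nonneg fun m => sub_nonneg.2 (servedProb_le_one hp0 hp1 a m)

theorem waitTime_mono (hp0 : 0 ≤ p) (hp1 : p < 1) {a b : Fin 3 → ℕ} (hab : a ≤ b) :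
    waitTime p a ≤ waitTime p b :=
  (summable_one_sub_servedProb hp0 hp1 a).tsum_le_tsum
    (fun m => sub_le_sub_left (servedProb_antitone hp0 hp1.le hab m) 1)
    (summable_one_sub_servedProb hp0 hp1 b)

/-- First-step analysis: the term m = 0 counts the transmission itself, and the later terms are
conditioned on its outcome. -/
theorem waitTime_eq (hp0 : 0 ≤ p) (hp1 : p < 1) (a : Fin 3 → ℕ) :
    waitTime p a = (if a = 0 then 0 else 1) + ∑ o, outcomeProb p o * waitTime p (serve a o) := by
  rw [waitTime, (summable_one_sub_servedProb hp0 hp1 a).tsum_eq_zero_add, servedProb_zero]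
  congr 1
  · split_ifs <;> simp
  · simp only [waitTime, ← tsum_mul_left]
    rw [← Summable.tsum_finsetSum fun o _ =>
      (summable_one_sub_servedProb hp0 hp1 (serve a o)).mul_left _]
    refine tsum_congr fun m => ?_
    simp only [servedProb_succ, mul_sub, Finset.sum_sub_distrib, mul_one, sum_outcomeProb]

theorem waitTime_zero : waitTime p ![0, 0, 0] = 0 := by
  simp [waitTime, servedProb, Fin.prod_univ_three, D₁_zero]

theorem waitTime_vec (hp0 : 0 ≤ p) (hp1 : p < 1) (a b c : ℕ) :
    waitTime p ![a, b, c] = (if a = 0 ∧ b = 0 ∧ c = 0 then 0 else 1) +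
      ((1 - p) * ((1 - p) * ((1 - p) * waitTime p ![a - 1, b - 1, c - 1] +
          p * waitTime p ![a - 1, b - 1, c]) +
        p * ((1 - p) * waitTime p ![a - 1, b, c - 1] + p * waitTime p ![a - 1, b, c])) +
      p * ((1 - p) * ((1 - p) * waitTime p ![a, b - 1, c - 1] + p * waitTime p ![a, b - 1, c]) +
        p * ((1 - p) * waitTime p ![a, b, c - 1] + p * waitTime p ![a, b, c]))) := by
  have hserve : ∀ x y z : Bool, serve ![a, b, c] ![x, y, z] =
      ![a - x.toNat, b - y.toNat, c - z.toNat] := fun x y z => by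
    ext i; fin_cases i <;> rfl
  have hz : ![a, b, c] = 0 ↔ a = 0 ∧ b = 0 ∧ c = 0 := by
    simp [funext_iff, Fin.forall_fin_succ]
  conv_lhs => rw [waitTime_eq hp0 hp1]
  simp only [hz, sum_outcome, hserve, outcomeProb, Fin.prod_univ_three, Fintype.sum_bool]
  simp
  ring

/-- The expected time until two clients have each received one more transmission. -/
def pairTime (p : ℝ) : ℝ := (1 + 2 * p) / (1 - p ^ 2)

/-- The expected completion time when each client lacks one dimension and every codeword is useless
for one of them: after the first reception by one of the other two, either only the useless client
is left, or it and one more. -/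
def stuckTime (p : ℝ) : ℝ := (1 + (1 - p) + 2 * (1 - p) * p * pairTime p) / (1 - p ^ 2)

theorem one_sub_sq_pos (hp0 : 0 ≤ p) (hp1 : p < 1) : 0 < 1 - p ^ 2 := by nlinarith

/-- First step with two useful clients: both receive with probability (1 - p)², leaving a mean of 1
/ (1 - p), whence the summand 1 - p. Exactly one receives with probability 2(1 - p)p, leaving a
pair; neither does with probability p², and the state persists. -/
theorem stuckTime_eq (hp0 : 0 ≤ p) (hp1 : p < 1) :
    stuckTime p = 1 + (1 - p) + 2 * (1 - p) * p * pairTime p + p ^ 2 * stuckTime p := by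
  have := one_sub_sq_pos hp0 hp1
  rw [stuckTime]; field_simp; ring

theorem stuckTime_nonneg (hp0 : 0 ≤ p) (hp1 : p < 1) : 0 ≤ stuckTime p := by
  have h := one_sub_sq_pos hp0 hp1
  have : 0 < 1 - p := sub_pos.2 hp1
  unfold stuckTime pairTime
  positivity

theorem waitTime_single (hp0 : 0 ≤ p) (hp1 : p < 1) :
    waitTime p ![1, 0, 0] = 1 / (1 - p) ∧ waitTime p ![0, 1, 0] = 1 / (1 - p) ∧
      waitTime p ![0, 0, 1] = 1 / (1 - p) := by
  have hs : 0 < 1 - p := sub_pos.2 hp1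
  have h1 := waitTime_vec hp0 hp1 1 0 0
  have h2 := waitTime_vec hp0 hp1 0 1 0
  have h3 := waitTime_vec hp0 hp1 0 0 1
  simp [waitTime_zero] at h1 h2 h3
  refine ⟨?_, ?_, ?_⟩ <;> rw [eq_div_iff hs.ne'] <;> linarith

theorem waitTime_pair (hp0 : 0 ≤ p) (hp1 : p < 1) :
    waitTime p ![0, 1, 1] = pairTime p ∧ waitTime p ![1, 0, 1] = pairTime p ∧
      waitTime p ![1, 1, 0] = pairTime p := by
  have hs : 0 < 1 - p := sub_pos.2 hp1
  have hq := one_sub_sq_pos hp0 hp1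
  obtain ⟨e1, e2, e3⟩ := waitTime_single hp0 hp1
  have h1 := waitTime_vec hp0 hp1 0 1 1
  have h2 := waitTime_vec hp0 hp1 1 0 1
  have h3 := waitTime_vec hp0 hp1 1 1 0
  have e : (1 - p) * (1 / (1 - p)) = 1 := mul_one_div_cancel hs.ne'
  simp [waitTime_zero] at h1 h2 h3
  rw [e2, e3] at h1
  rw [e1, e3] at h2
  rw [e1, e2] at h3
  refine ⟨?_, ?_, ?_⟩ <;> rw [pairTime, eq_div_iff hq.ne']
  · linear_combination h1 + 2 * p * e
  · linear_combination h2 + 2 * p * e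
  · linear_combination h3 + 2 * p * e

/-- Solving the first-step equations upwards from small demands gives closed forms. The numerator of
their difference has only nonnegative coefficients in p. -/
theorem stuckTime_le_waitTime (hp0 : 0 ≤ p) (hp1 : p < 1) :
    stuckTime p ≤ waitTime p ![1, 1, 2] := by
  have hs : 0 < 1 - p := sub_pos.2 hp1
  have hq := one_sub_sq_pos hp0 hp1
  obtain ⟨e1, e2, e3⟩ := waitTime_single hp0 hp1
  obtain ⟨f1, f2, f3⟩ := waitTime_pair hp0 hp1
  have h1 := waitTime_vec hp0 hp1 0 0 2
  have h2 := waitTime_vec hp0 hp1 0 1 2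
  have h3 := waitTime_vec hp0 hp1 1 0 2
  have h4 := waitTime_vec hp0 hp1 1 1 1
  have h5 := waitTime_vec hp0 hp1 1 1 2
  simp [waitTime_zero] at h1 h2 h3 h4 h5
  have hb : 0 < 1 + p := by linarith
  have hd : 0 < 1 + p + p ^ 2 := by positivity
  have hM : pairTime p = (1 + 2 * p) / ((1 - p) * (1 + p)) := by rw [pairTime]; congr 1; ring
  have h002 : waitTime p ![0, 0, 2] = 2 / (1 - p) := by
    rw [e3] at h1
    rw [eq_div_iff hs.ne']
    field_simp at h1
    linear_combination h1
  have h012 : waitTime p ![0, 1, 2] = (2 + 4 * p + 3 * p ^ 2) / ((1 - p) * (1 + p) ^ 2) := by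
    rw [f1, e3, h002, hM] at h2
    rw [eq_div_iff (by positivity)]
    field_simp at h2
    linear_combination h2
  have h102 : waitTime p ![1, 0, 2] = (2 + 4 * p + 3 * p ^ 2) / ((1 - p) * (1 + p) ^ 2) := by
    rw [f2, e3, h002, hM] at h3
    rw [eq_div_iff (by positivity)]
    field_simp at h3
    linear_combination h3
  have h111 : waitTime p ![1, 1, 1] =
      (1 + 4 * p + 3 * p ^ 2 + 3 * p ^ 3) / ((1 - p) * (1 + p) * (1 + p + p ^ 2)) := by
    rw [e1, e2, e3, f1, f2, f3, hM] at h4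
    rw [eq_div_iff (by positivity)]
    field_simp at h4
    linear_combination h4
  have h112 : waitTime p ![1, 1, 2] =
      (2 + 8 * p + 18 * p ^ 2 + 24 * p ^ 3 + 21 * p ^ 4 + 11 * p ^ 5 + 4 * p ^ 6) /
        ((1 - p) * (1 + p) ^ 2 * (1 + p + p ^ 2) ^ 2) := by
    rw [e3, f1, f2, h002, h012, h102, h111, hM] at h5
    rw [eq_div_iff (by positivity)]
    field_simp at h5
    linear_combination h5
  have hstuck : stuckTime p = (2 + 3 * p + 3 * p ^ 2) / ((1 - p) * (1 + p) ^ 2) := by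
    rw [stuckTime, hM]
    field_simp
    ring
  rw [h112, hstuck, ← sub_nonneg]
  have : (2 + 8 * p + 18 * p ^ 2 + 24 * p ^ 3 + 21 * p ^ 4 + 11 * p ^ 5 + 4 * p ^ 6) /
        ((1 - p) * (1 + p) ^ 2 * (1 + p + p ^ 2) ^ 2) -
      (2 + 3 * p + 3 * p ^ 2) / ((1 - p) * (1 + p) ^ 2) =
      (p + 3 * p ^ 2 + 5 * p ^ 3 + 4 * p ^ 4 + 2 * p ^ 5 + p ^ 6) /
        ((1 - p) * (1 + p) ^ 2 * (1 + p + p ^ 2) ^ 2) := by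
    field_simp
    ring
  rw [this]
  positivity

end Wait

/-! ### Covering a vector space over `GF(2)` by proper subspaces -/

section Cover

variable {V : Type*} [AddCommGroup V] [Module (ZMod 2) V]

/-- If u lies in W but not U and w in U but not W, then u + w avoids both. The implications let
satisfied clients impose no condition. -/
theorem exists_notMem_of_ne_top (U W : Submodule (ZMod 2) V) :
    ∃ w, (U ≠ ⊤ → w ∉ U) ∧ (W ≠ ⊤ → w ∉ W) := by
  by_cases hU : U = ⊤
  · by_cases hW : W = ⊤
    · exact ⟨0, fun h => (h hU).elim, fun h => (h hW).elim⟩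
    · obtain ⟨w, -, hw⟩ := SetLike.exists_of_lt (lt_top_iff_ne_top.2 hW)
      exact ⟨w, fun h => (h hU).elim, fun _ => hw⟩
  · obtain ⟨u, -, hu⟩ := SetLike.exists_of_lt (lt_top_iff_ne_top.2 hU)
    by_cases hW : W = ⊤
    · exact ⟨u, fun _ => hu, fun h => (h hW).elim⟩
    · obtain ⟨w, -, hw⟩ := SetLike.exists_of_lt (lt_top_iff_ne_top.2 hW)
      by_cases huW : u ∈ W
      · by_cases hwU : w ∈ U
        · exact ⟨u + w, fun _ h => hu ((U.add_mem_iff_left hwU).1 h),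
            fun _ h => hw ((W.add_mem_iff_right huW).1 h)⟩
        · exact ⟨w, fun _ => hwU, fun _ => hw⟩
      · exact ⟨u, fun _ => hu, fun _ => huW⟩

/-- If three proper subspaces over `GF(2)` cover the space, the sum of two vectors outside of the
third one lies in it. -/
theorem add_mem_of_cover {A B C : Submodule (ZMod 2) V} (hA : A ≠ ⊤) (hB : B ≠ ⊤) (hC : C ≠ ⊤)
    (hcov : ∀ w, w ∈ A ∨ w ∈ B ∨ w ∈ C) {u v : V} (hu : u ∉ C) (hv : v ∉ C) : u + v ∈ C := by
  obtain ⟨x, hxA, hxB⟩ := exists_notMem_of_ne_top A B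
  replace hxA := hxA hA
  replace hxB := hxB hB
  have hxC : x ∈ C := by have := hcov x; tauto
  -- Translating x, which avoids A and B, by a vector of A ∩ B keeps it outside both, so in C; thus
  -- A ∩ B ⊆ C.
  have hAB : ∀ z, z ∈ A → z ∈ B → z ∈ C := fun z hzA hzB => by
    have h1 : x + z ∉ A := fun h => hxA ((A.add_mem_iff_left hzA).1 h)
    have h2 : x + z ∉ B := fun h => hxB ((B.add_mem_iff_left hzB).1 h)
    have h3 : x + z ∈ C := by have := hcov (x + z); tauto
    exact (C.add_mem_iff_right hxC).1 h3
  have key : ∀ {A B : Submodule (ZMod 2) V}, A ≠ ⊤ → (∀ w, w ∈ A ∨ w ∈ B ∨ w ∈ C) →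
      (∀ z, z ∈ A → z ∈ B → z ∈ C) → ∀ {u v : V}, u ∈ A → v ∈ A → u ∉ C → v ∉ C →
      u + v ∈ C := fun {A B} hA hcov hAB {u v} huA hvA hu hv => by
    obtain ⟨y, hyA, hyC⟩ := exists_notMem_of_ne_top A C
    replace hyA := hyA hA
    replace hyC := hyC hC
    have hyB : y ∈ B := by have := hcov y; tauto
    have aux : ∀ {t}, t ∈ A → t ∉ C → t + y ∈ C := fun {t} htA ht => by
      have h1 : t + y ∉ A := fun h => hyA ((A.add_mem_iff_right htA).1 h)
      have h2 : t + y ∉ B := fun h => ht (hAB t htA ((B.add_mem_iff_left hyB).1 h))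
      have := hcov (t + y); tauto
    -- Both u + y and v + y lie in C, and 2v = 0 in characteristic two.
    have h : u + v = (u + y) - (v + y) + (2 : ZMod 2) • v := by
      rw [two_smul]; abel
    rw [h, show (2 : ZMod 2) = 0 from rfl, zero_smul, add_zero]
    exact C.sub_mem (aux huA hu) (aux hvA hv)
  have mixed : ∀ {u v : V}, u ∈ A → v ∈ B → u ∉ C → v ∉ C → u + v ∈ C :=
    fun {u v} huA hvB hu hv => by
      have h1 : u + v ∉ A := fun h => hv (hAB v ((A.add_mem_iff_right huA).1 h) hvB)
      have h2 : u + v ∉ B := fun h => hu (hAB u huA ((B.add_mem_iff_left hvB).1 h))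
      have := hcov (u + v); tauto
  rcases hcov u with huA | huB | h
  · rcases hcov v with hvA | hvB | h
    · exact key hA hcov hAB huA hvA hu hv
    · exact mixed huA hvB hu hv
    · exact (hv h).elim
  · rcases hcov v with hvA | hvB | h
    · rw [add_comm]; exact mixed hvA huB hv hu
    · exact key hB (fun w => by have := hcov w; tauto) (fun z hB hA => hAB z hA hB) huB hvB hu hv
    · exact (hv h).elim
  · exact (hu h).elim

theorem finrank_eq_of_cover [Module.Finite (ZMod 2) V] {A B C : Submodule (ZMod 2) V}
    (hA : A ≠ ⊤) (hB : B ≠ ⊤) (hC : C ≠ ⊤) (hcov : ∀ w, w ∈ A ∨ w ∈ B ∨ w ∈ C) :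
    Module.finrank (ZMod 2) C + 1 = Module.finrank (ZMod 2) V := by
  obtain ⟨u, -, hu⟩ := SetLike.exists_of_lt (lt_top_iff_ne_top.2 hC)
  suffices htop : C ⊔ Submodule.span (ZMod 2) {u} = ⊤ by
    rw [← Submodule.finrank_sup_span_singleton hu, htop, finrank_top]
  refine eq_top_iff.2 fun v _ => ?_
  by_cases hv : v ∈ C
  · exact Submodule.mem_sup_left hv
  · rw [show v = (v + u) - u by abel]
    exact Submodule.sub_mem _ (Submodule.mem_sup_left (add_mem_of_cover hA hB hC hcov hv hu))
      (Submodule.mem_sup_right (Submodule.mem_span_singleton_self u))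

theorem eq_or_eq_add_one_or_eq_add_two (i j : Fin 3) : j = i ∨ j = i + 1 ∨ j = i + 2 := by
  decide +revert

theorem exists_notMem_or_cover (U : Fin 3 → Submodule (ZMod 2) V) :
    (∃ w, ∀ i, U i ≠ ⊤ → w ∉ U i) ∨ (∀ i, U i ≠ ⊤) ∧ ∀ w, ∃ i, w ∈ U i := by
  by_cases h : ∀ i, U i ≠ ⊤
  · by_cases hc : ∀ w, ∃ i, w ∈ U i
    · exact Or.inr ⟨h, hc⟩
    · push Not at hc
      exact Or.inl (hc.imp fun w hw i _ => hw i)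
  · push Not at h
    obtain ⟨i, hi⟩ := h
    left
    obtain ⟨w, h1, h2⟩ := exists_notMem_of_ne_top (U (i + 1)) (U (i + 2))
    refine ⟨w, fun j => ?_⟩
    rcases eq_or_eq_add_one_or_eq_add_two i j with rfl | rfl | rfl
    exacts [fun h => (h hi).elim, h1, h2]

theorem finrank_eq_of_cover_fin [Module.Finite (ZMod 2) V] {U : Fin 3 → Submodule (ZMod 2) V}
    (hU : ∀ i, U i ≠ ⊤) (hcov : ∀ w, ∃ i, w ∈ U i) (i : Fin 3) :
    Module.finrank (ZMod 2) (U i) + 1 = Module.finrank (ZMod 2) V := by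
  refine finrank_eq_of_cover (hU (i + 1)) (hU (i + 2)) (hU i) fun w => ?_
  obtain ⟨j, hj⟩ := hcov w
  rcases eq_or_eq_add_one_or_eq_add_two i j with rfl | rfl | rfl <;> simp [hj]

end Cover

/-! ### Greedy policies -/

section Greedy

variable {k : ℕ} {π : Policy k} {h : List Outcome} {i : Fin 3} {o : Outcome}

/-- The span of the coding vectors which client `i` has received. -/
def knowledge (π : Policy k) (h : List Outcome) (i : Fin 3) :
    Submodule (ZMod 2) (CodingVector k) :=
  Submodule.span (ZMod 2) (received π i h)

theorem rank_eq (π : Policy k) (i : Fin 3) (h : List Outcome) :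
    rank π i h = Module.finrank (ZMod 2) (knowledge π h i) := rfl

theorem rank_le (π : Policy k) (i : Fin 3) (h : List Outcome) : rank π i h ≤ k := by
  simpa [rank_eq] using Submodule.finrank_le (knowledge π h i)

theorem rank_eq_iff : rank π i h = k ↔ knowledge π h i = ⊤ := by
  refine ⟨fun hr => Submodule.eq_top_of_finrank_eq (hr.trans (by simp)), fun hr => ?_⟩
  rw [rank_eq, hr]; simp

theorem knowledge_cons_of_false (ho : o i = false) :
    knowledge π (o :: h) i = knowledge π h i := by
  simp [knowledge, received, ho]

theorem knowledge_cons_of_true (ho : o i = true) :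
    knowledge π (o :: h) i = knowledge π h i ⊔ Submodule.span (ZMod 2) {π h} := by
  simp only [knowledge, received, ho, if_true, Submodule.span_insert]
  exact sup_comm _ _

theorem knowledge_cons_of_mem (hm : π h ∈ knowledge π h i) :
    knowledge π (o :: h) i = knowledge π h i := by
  cases ho : o i
  · exact knowledge_cons_of_false ho
  · rw [knowledge_cons_of_true ho, sup_eq_left, Submodule.span_singleton_le_iff_mem]
    exact hm

theorem rank_cons_of_notMem (hm : π h ∉ knowledge π h i) :
    rank π i (o :: h) = rank π i h + (o i).toNat := by
  cases ho : o i
  · rw [rank_eq, knowledge_cons_of_false ho]; rfl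
  · rw [rank_eq, knowledge_cons_of_true ho, Submodule.finrank_sup_span_singleton hm]; rfl

/-- No client is satisfied, and no codeword is innovative for all of them. -/
def Stuck (π : Policy k) (h : List Outcome) : Prop :=
  (∀ i, knowledge π h i ≠ ⊤) ∧ ∀ w, ∃ i, w ∈ knowledge π h i

theorem Stuck.rank_add_one (hst : Stuck π h) (i : Fin 3) : rank π i h + 1 = k := by
  simpa [rank_eq] using finrank_eq_of_cover_fin hst.1 hst.2 i

/-- The number of dimensions each client still lacks. -/
def deficit (π : Policy k) (h : List Outcome) : Fin 3 → ℕ := fun i => k - rank π i h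

theorem deficit_eq_zero_iff : deficit π h i = 0 ↔ knowledge π h i = ⊤ := by
  have := rank_le π i h
  rw [← rank_eq_iff, deficit]; omega

theorem deficit_eq_zero_iff_allSatisfied : deficit π h = 0 ↔ AllSatisfied π h := by
  simp [funext_iff, deficit_eq_zero_iff, AllSatisfied, rank_eq_iff]

theorem deficit_cons_of_mem (hm : π h ∈ knowledge π h i) :
    deficit π (o :: h) i = deficit π h i := by
  rw [deficit, rank_eq, knowledge_cons_of_mem hm]; rfl

theorem deficit_cons_of_notMem (hm : π h ∉ knowledge π h i) :
    deficit π (o :: h) i = deficit π h i - (o i).toNat := by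
  simp only [deficit, rank_cons_of_notMem hm]; omega

theorem deficit_cons (hm : ∀ i, knowledge π h i ≠ ⊤ → π h ∉ knowledge π h i) (o : Outcome) :
    deficit π (o :: h) = serve (deficit π h) o := by
  funext i
  by_cases hi : π h ∈ knowledge π h i
  · have h0 : deficit π h i = 0 := deficit_eq_zero_iff.2 (by_contra fun hne => hm i hne hi)
    rw [deficit_cons_of_mem hi, serve, h0, Nat.zero_sub]
  · exact deficit_cons_of_notMem hi

/-- Some vector serves all unsatisfied clients. No vector serves more, so maximality of the greedy
count forces equality of the two sets of clients. -/
theorem IsGreedy.notMem (hπ : IsGreedy π) (hst : ¬ Stuck π h) (i : Fin 3)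
    (hi : knowledge π h i ≠ ⊤) : π h ∉ knowledge π h i := by
  obtain ⟨w, hw⟩ := (exists_notMem_or_cover (knowledge π h)).resolve_right hst
  have hsub : innovativeFor π h (π h) ⊆ innovativeFor π h w := fun j hj =>
    hw j fun htop => hj (show π h ∈ knowledge π h j by rw [htop]; trivial)
  have heq := Set.eq_of_subset_of_ncard_le hsub (hπ h w)
  have : i ∈ innovativeFor π h w := hw i hi
  rwa [← heq] at this

/-- Avoiding two of the subspaces is always possible, so the greedy count is at least two; the
covering excludes three. -/
theorem IsGreedy.exists_of_stuck (hπ : IsGreedy π) (hst : Stuck π h) :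
    ∃ i, π h ∈ knowledge π h i ∧ ∀ j, j ≠ i → π h ∉ knowledge π h j := by
  obtain ⟨w, h0, h1⟩ := exists_notMem_of_ne_top (knowledge π h 0) (knowledge π h 1)
  have hsub : ({0, 1} : Set (Fin 3)) ⊆ innovativeFor π h w := by
    rintro j (rfl | rfl)
    exacts [h0 (hst.1 0), h1 (hst.1 1)]
  have hle : 2 ≤ (innovativeFor π h (π h)).ncard :=
    (Set.ncard_pair (by decide)).ge.trans ((Set.ncard_le_ncard hsub).trans (hπ h w))
  obtain ⟨i, hi⟩ := hst.2 (π h)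
  refine ⟨i, hi, fun j hj hjm => ?_⟩
  have hsub' : innovativeFor π h (π h) ⊆ ({i, j} : Set (Fin 3))ᶜ := by
    rintro l hl (rfl | rfl)
    exacts [hl hi, hl hjm]
  have := Set.ncard_le_ncard hsub'
  rw [Set.ncard_compl, Set.ncard_pair hj.symm] at this
  rw [Nat.card_eq_fintype_card, Fintype.card_fin] at this
  omega

/-- The set of codewords held by each client when `choose` selects the next coding vector from
the codewords held. -/
def holdings (choose : (Fin 3 → Set (CodingVector k)) → CodingVector k) :
    List Outcome → Fin 3 → Set (CodingVector k)
  | [] => fun _ => ∅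
  | o :: h => fun i =>
    if o i = true then insert (choose (holdings choose h)) (holdings choose h i)
    else holdings choose h i

theorem exists_isGreedy (k : ℕ) : ∃ π : Policy k, IsGreedy π := by
  have hmax : ∀ Y : Fin 3 → Set (CodingVector k), ∃ v : CodingVector k, ∀ w,
      {i | w ∉ Submodule.span (ZMod 2) (Y i)}.ncard ≤
        {i | v ∉ Submodule.span (ZMod 2) (Y i)}.ncard :=
    fun Y => Finite.exists_max fun w => {i | w ∉ Submodule.span (ZMod 2) (Y i)}.ncard
  choose c hc using hmax
  have hY : ∀ h i, received (fun h => c (holdings c h)) i h = holdings c h i := by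
    intro h i
    induction h with
    | nil => rfl
    | cons o h ih => simp only [received, holdings, ih]
  refine ⟨fun h => c (holdings c h), fun h w => ?_⟩
  simp only [innovativeFor, hY]
  exact hc (holdings c h) w

end Greedy

/-! ### The potential of a greedy policy -/

section Potential

variable {k : ℕ} {π : Policy k} {h : List Outcome} {p : ℝ}

open Classical in
/-- An upper bound for the expected remaining completion time. As long as the policy may still get
stuck, the third client is charged an additional reception. -/
def potential (p : ℝ) (π : Policy k) (h : List Outcome) : ℝ :=
  if Stuck π h then stuckTime p
  else if ∃ i, knowledge π h i = ⊤ then waitTime p (deficit π h)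
  else waitTime p (deficit π h + Pi.single 2 1)

theorem potential_nonneg (hp0 : 0 ≤ p) (hp1 : p < 1) : 0 ≤ potential p π h := by
  unfold potential
  split_ifs
  exacts [stuckTime_nonneg hp0 hp1, waitTime_nonneg hp0 hp1.le _, waitTime_nonneg hp0 hp1.le _]

theorem potential_of_satisfied {i : Fin 3} (hi : knowledge π h i = ⊤) :
    potential p π h = waitTime p (deficit π h) := by
  rw [potential, if_neg fun hst => hst.1 i hi, if_pos ⟨i, hi⟩]

theorem Stuck.deficit_eq (hst : Stuck π h) (i : Fin 3) : deficit π h i = 1 := by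
  have := hst.rank_add_one i
  rw [deficit]; omega

theorem potential_le (hp0 : 0 ≤ p) (hp1 : p < 1) (π : Policy k) (h : List Outcome) :
    potential p π h ≤ waitTime p (deficit π h + Pi.single 2 1) := by
  unfold potential
  split_ifs with hst
  · have : deficit π h + Pi.single 2 1 = ![1, 1, 2] := by
      funext i
      rw [Pi.add_apply, hst.deficit_eq]
      fin_cases i <;> rfl
    rw [this]
    exact stuckTime_le_waitTime hp0 hp1
  · exact waitTime_mono hp0 hp1 (le_add_of_nonneg_right zero_le)
  · exact le_rfl

theorem potential_cons_of_stuck (hst : Stuck π h) {i : Fin 3} (hi : π h ∈ knowledge π h i)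
    (hj : ∀ j, j ≠ i → π h ∉ knowledge π h j) (o : Outcome) :
    potential p π (o :: h) = if ∀ j, j ≠ i → o j = false then stuckTime p
      else waitTime p fun j => if j = i then 1 else 1 - (o j).toNat := by
  split_ifs with ho
  · have hk : knowledge π (o :: h) = knowledge π h := by
      funext j
      by_cases hji : j = i
      · rw [hji]; exact knowledge_cons_of_mem hi
      · exact knowledge_cons_of_false (ho j hji)
    rw [potential, if_pos]
    rwa [Stuck, hk]
  · push Not at ho
    obtain ⟨j, hji, hoj⟩ := ho
    have hd : ∀ l, deficit π (o :: h) l = if l = i then 1 else 1 - (o l).toNat := fun l => by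
      split_ifs with hl
      · rw [hl, deficit_cons_of_mem hi, hst.deficit_eq]
      · rw [deficit_cons_of_notMem (hj l hl), hst.deficit_eq]
    have hz : deficit π (o :: h) j = 0 := by
      rw [hd, if_neg hji, Bool.eq_true_of_not_eq_false hoj]; rfl
    rw [potential_of_satisfied (deficit_eq_zero_iff.1 hz)]
    exact congrArg _ (funext hd)

theorem sum_potential_of_stuck (hp0 : 0 ≤ p) (hp1 : p < 1) (hπ : IsGreedy π) (hst : Stuck π h) :
    1 + ∑ o, outcomeProb p o * potential p π (o :: h) = stuckTime p := by
  obtain ⟨i, hi, hj⟩ := hπ.exists_of_stuck hst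
  have hs : 0 < 1 - p := sub_pos.2 hp1
  have e : (1 - p) * (1 / (1 - p)) = 1 := mul_one_div_cancel hs.ne'
  obtain ⟨e1, e2, e3⟩ := waitTime_single hp0 hp1
  obtain ⟨f1, f2, f3⟩ := waitTime_pair hp0 hp1
  obtain ⟨W, hW⟩ : ∃ W : ℕ → ℕ → ℕ → ℝ, ∀ a : Fin 3 → ℕ, waitTime p a = W (a 0) (a 1) (a 2) :=
    ⟨fun x y z => waitTime p ![x, y, z], fun a =>
      congrArg _ (by funext i; fin_cases i <;> rfl)⟩
  have hE := stuckTime_eq hp0 hp1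
  simp only [potential_cons_of_stuck hst hi hj]
  simp only [sum_outcome, outcomeProb, Fin.prod_univ_three, Fintype.sum_bool]
  simp [hW] at e1 e2 e3 f1 f2 f3
  clear hst hi hj
  fin_cases i <;> simp [hW, Fin.forall_fin_succ, e1, e2, e3, f1, f2, f3] <;>
    linear_combination (1 - p) * e - hE

/-- Equality holds in the stuck state and once some client is satisfied. Otherwise the charged
demands evolve ideally, and `potential_le` absorbs a possible entry into either of the other
regimes. -/
theorem potential_drift (hp0 : 0 ≤ p) (hp1 : p < 1) (hπ : IsGreedy π) (h : List Outcome)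
    [Decidable (AllSatisfied π h)] :
    (if AllSatisfied π h then 0 else 1) + ∑ o, outcomeProb p o * potential p π (o :: h) ≤
      potential p π h := by
  by_cases hst : Stuck π h
  · have hns : ¬ AllSatisfied π h := fun hs => hst.1 0 (rank_eq_iff.1 (hs 0))
    rw [if_neg hns, sum_potential_of_stuck hp0 hp1 hπ hst, potential, if_pos hst]
  have hd := deficit_cons (hπ.notMem hst)
  by_cases hsat : ∃ i, knowledge π h i = ⊤
  · obtain ⟨i, hi⟩ := hsat
    have hi' : ∀ o, knowledge π (o :: h) i = ⊤ := fun o => by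
      rw [knowledge_cons_of_mem (by rw [hi]; trivial), hi]
    simp only [potential_of_satisfied hi, potential_of_satisfied (hi' _), hd,
      ← deficit_eq_zero_iff_allSatisfied]
    rw [waitTime_eq hp0 hp1 (deficit π h)]
  · have hV : potential p π h = waitTime p (deficit π h + Pi.single 2 1) := by
      rw [potential, if_neg hst, if_neg hsat]
    have hne : deficit π h + Pi.single 2 1 ≠ 0 := fun h0 => by simpa using congrFun h0 2
    rw [hV, waitTime_eq hp0 hp1, if_neg hne]
    refine add_le_add (by split_ifs <;> simp) (Finset.sum_le_sum fun o _ =>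
      mul_le_mul_of_nonneg_left ?_ (outcomeProb_nonneg hp0 hp1.le o))
    refine (potential_le hp0 hp1 π (o :: h)).trans_eq (congrArg _ ?_)
    rw [hd]
    funext j
    -- With every deficit positive, truncated subtraction commutes with adding the extra reception.
    -- This fails for a satisfied third client, hence the uncharged regime.
    have hpos : 0 < deficit π h j := Nat.pos_of_ne_zero fun h0 =>
      hsat ⟨j, deficit_eq_zero_iff.1 h0⟩
    have := Bool.toNat_le (o j)
    simp only [serve, Pi.add_apply]
    omega

end Potential

/-! ### Expectations over histories -/

section Probability

variable {Ω : Type*} {R : ℕ → Fin 3 → Ω → Bool}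

/-- The first `m` outcomes at the sample point `ω`. -/
def historyAt (R : ℕ → Fin 3 → Ω → Bool) (m : ℕ) (ω : Ω) : List Outcome :=
  history (fun t i => R t i ω) m

theorem historyAt_succ (R : ℕ → Fin 3 → Ω → Bool) (m : ℕ) (ω : Ω) :
    historyAt R (m + 1) ω = (fun i => R m i ω) :: historyAt R m ω := rfl

theorem history_eq_of_forall_lt {r r' : ℕ → Outcome} {m : ℕ} (h : ∀ t < m, r t = r' t) :
    history r m = history r' m := by
  induction m with
  | zero => rfl
  | succ m ih => rw [history, history, h m m.lt_succ_self,
      ih fun t ht => h t (ht.trans m.lt_succ_self)]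

/-- The history as a function of the finitely many receptions it depends on. -/
theorem exists_historyAt_eq (R : ℕ → Fin 3 → Ω → Bool) (m : ℕ) :
    ∃ F : ((x : (Finset.range m ×ˢ Finset.univ : Finset (ℕ × Fin 3))) → Bool) → List Outcome,
      ∀ ω, historyAt R m ω = F fun x => R x.1.1 x.1.2 ω := by
  refine ⟨fun f => history (fun t i => if ht : t < m then f ⟨(t, i), by simpa using ht⟩ else false)
    m, fun ω => history_eq_of_forall_lt fun t ht => ?_⟩
  simp [ht]

variable [MeasurableSpace Ω] {μ : Measure Ω} {p : ℝ}

/-- The two functions depend on disjoint sets of reception variables. -/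
theorem indepFun_historyAt (hmeas : ∀ t i, Measurable (R t i))
    (hindep : iIndepFun (fun x : ℕ × Fin 3 => R x.1 x.2) μ) (m : ℕ)
    (f : Outcome → ℝ≥0∞) (g : List Outcome → ℝ≥0∞) :
    (fun ω => f fun i => R m i ω) ⟂ᵢ[μ] fun ω => g (historyAt R m ω) := by
  obtain ⟨F, hF⟩ := exists_historyAt_eq R m
  have hdisj : Disjoint ({m} ×ˢ Finset.univ : Finset (ℕ × Fin 3))
      (Finset.range m ×ˢ Finset.univ) := by
    rw [Finset.disjoint_left]
    rintro ⟨t, i⟩ h1 h2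
    simp at h1 h2
    omega
  have h := hindep.indepFun_finset _ _ hdisj fun x => hmeas x.1 x.2
  simp only [hF]
  exact h.comp (φ := fun v => f fun i => v ⟨(m, i), by simp⟩) (ψ := fun v => g (F v))
    (measurable_of_finite _) (measurable_of_finite _)

theorem measurable_comp_historyAt (hmeas : ∀ t i, Measurable (R t i)) (m : ℕ)
    (g : List Outcome → ℝ≥0∞) : Measurable fun ω => g (historyAt R m ω) := by
  obtain ⟨F, hF⟩ := exists_historyAt_eq R m
  simp only [hF]
  exact (measurable_of_finite fun v => g (F v)).comp
    (measurable_pi_lambda _ fun x => hmeas x.1.1 x.1.2)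

theorem measurable_comp_outcome (hmeas : ∀ t i, Measurable (R t i)) (m : ℕ)
    (f : Outcome → ℝ≥0∞) : Measurable fun ω => f fun i => R m i ω :=
  (measurable_of_finite f).comp (measurable_pi_lambda _ fun i => hmeas m i)

theorem measure_outcome [IsProbabilityMeasure μ] (hp0 : 0 ≤ p) (hp1 : p ≤ 1)
    (hmeas : ∀ t i, Measurable (R t i))
    (hindep : iIndepFun (fun x : ℕ × Fin 3 => R x.1 x.2) μ)
    (hbern : ∀ t i, μ {ω | R t i ω = true} = ENNReal.ofReal (1 - p)) (m : ℕ) (o : Outcome) :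
    μ {ω | (fun i => R m i ω) = o} = ENNReal.ofReal (outcomeProb p o) := by
  have h := (hindep.precomp (g := fun i : Fin 3 => (m, i))
    fun _ _ h => (Prod.mk.inj h).2).meas_iInter
    (s := fun i => {ω | R m i ω = o i}) fun i => ⟨{o i}, trivial, rfl⟩
  have hset : {ω | (fun i => R m i ω) = o} = ⋂ i, {ω | R m i ω = o i} := by
    ext ω; simp [funext_iff]
  rw [hset, h, outcomeProb, ENNReal.ofReal_prod_of_nonneg fun i _ => by split_ifs <;> linarith]
  refine Finset.prod_congr rfl fun i _ => ?_
  cases hoi : o i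
  · have hc : {ω | R m i ω = false} = {ω | R m i ω = true}ᶜ := by ext ω; simp
    have hm : MeasurableSet {ω | R m i ω = true} := hmeas m i (measurableSet_singleton true)
    rw [hc, prob_compl_eq_one_sub hm, hbern,
      ← ENNReal.ofReal_one, ← ENNReal.ofReal_sub _ (sub_nonneg.2 hp1)]
    simp
  · simp [hbern]

theorem lintegral_historyAt_succ [IsProbabilityMeasure μ] (hp0 : 0 ≤ p) (hp1 : p ≤ 1)
    (hmeas : ∀ t i, Measurable (R t i))
    (hindep : iIndepFun (fun x : ℕ × Fin 3 => R x.1 x.2) μ)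
    (hbern : ∀ t i, μ {ω | R t i ω = true} = ENNReal.ofReal (1 - p)) (m : ℕ)
    (g : List Outcome → ℝ≥0∞) :
    ∫⁻ ω, g (historyAt R (m + 1) ω) ∂μ =
      ∑ o, ENNReal.ofReal (outcomeProb p o) * ∫⁻ ω, g (o :: historyAt R m ω) ∂μ := by
  have hsplit : ∀ ω, g (historyAt R (m + 1) ω) = ∑ o : Outcome,
      (if (fun i => R m i ω) = o then 1 else 0) * g (o :: historyAt R m ω) := fun ω => by
    simp [historyAt_succ]
  have hf := fun o : Outcome =>
    measurable_comp_outcome hmeas m fun o' => if o' = o then (1 : ℝ≥0∞) else 0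
  have hg := fun o : Outcome => measurable_comp_historyAt hmeas m fun h => g (o :: h)
  simp only [hsplit]
  refine (lintegral_finsetSum _ fun o _ => (hf o).mul (hg o)).trans ?_
  refine Finset.sum_congr rfl fun o _ => ?_
  refine (lintegral_mul_eq_lintegral_mul_lintegral_of_indepFun (hf o) (hg o)
    (indepFun_historyAt hmeas hindep m (fun o' => if o' = o then 1 else 0)
      fun h => g (o :: h))).trans ?_
  congr 1
  rw [← measure_outcome hp0 hp1 hmeas hindep hbern m o]
  have hms : MeasurableSet {ω | (fun i => R m i ω) = o} :=
    (measurable_pi_lambda _ fun i => hmeas m i) (measurableSet_singleton o)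
  rw [← lintegral_indicator_one hms]
  exact lintegral_congr fun ω => by simp [Set.indicator_apply]

end Probability

/-! ### Hitting times as sums -/

open Classical in
-- Every index before the first hit contributes 1. Later failures only enlarge the sum, so no
-- monotonicity is needed for an upper bound.
theorem iInf_le_tsum_not (P : ℕ → Prop) :
    ⨅ (m : ℕ) (_ : P m), (m : ℝ≥0∞) ≤ ∑' m, if P m then 0 else 1 := by
  by_cases h : ∃ m, P m
  · refine (iInf₂_le (Nat.find h) (Nat.find_spec h)).trans ?_
    refine le_trans (le_of_eq ?_) (ENNReal.sum_le_tsum (Finset.range (Nat.find h)))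
    rw [Finset.sum_congr rfl fun m hm => if_neg (Nat.find_min h (Finset.mem_range.1 hm))]
    simp
  · push Not at h
    simp [h]

open Classical in
theorem iInf_eq_tsum_not {P : ℕ → Prop} (hP : Monotone P) :
    ⨅ (m : ℕ) (_ : P m), (m : ℝ≥0∞) = ∑' m, if P m then 0 else 1 := by
  refine le_antisymm (iInf_le_tsum_not P) (le_iInf₂ fun m hm => ?_)
  rw [tsum_eq_sum (s := Finset.range m) fun n hn =>
    if_pos (hP (not_lt.1 (mt Finset.mem_range.2 hn)) hm)]
  refine (Finset.sum_le_card_nsmul _ _ 1 fun n _ => ?_).trans (by simp)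
  split_ifs <;> simp

/-! ### Expected completion time and the value of E[ℓ] -/

section Expectation

variable {Ω : Type*} [MeasurableSpace Ω] {μ : Measure Ω} [IsProbabilityMeasure μ] {p : ℝ}
  {R : ℕ → Fin 3 → Ω → Bool} {k : ℕ}

open Classical in
-- The supermartingale inequality: elapsed unfinished time plus current potential does not increase
-- in expectation.
theorem sum_lintegral_add_potential_le (hp0 : 0 ≤ p) (hp1 : p < 1)
    (hmeas : ∀ t i, Measurable (R t i))
    (hindep : iIndepFun (fun x : ℕ × Fin 3 => R x.1 x.2) μ)
    (hbern : ∀ t i, μ {ω | R t i ω = true} = ENNReal.ofReal (1 - p))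
    {π : Policy k} (hπ : IsGreedy π) (n : ℕ) :
    ∑ m ∈ Finset.range n, ∫⁻ ω, (if AllSatisfied π (historyAt R m ω) then 0 else 1) ∂μ +
      ∫⁻ ω, ENNReal.ofReal (potential p π (historyAt R n ω)) ∂μ ≤
        ENNReal.ofReal (potential p π []) := by
  have hmg := fun (g : List Outcome → ℝ≥0∞) m => measurable_comp_historyAt hmeas m g
  induction n with
  | zero => simp [historyAt, history]
  | succ n ih =>
    refine le_trans ?_ ih
    rw [Finset.sum_range_succ, add_assoc,
      lintegral_historyAt_succ hp0 hp1.le hmeas hindep hbern n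
        fun h => ENNReal.ofReal (potential p π h)]
    refine add_le_add le_rfl ?_
    have hmul : ∀ o, ENNReal.ofReal (outcomeProb p o) *
          ∫⁻ ω, ENNReal.ofReal (potential p π (o :: historyAt R n ω)) ∂μ =
        ∫⁻ ω, ENNReal.ofReal (outcomeProb p o) *
          ENNReal.ofReal (potential p π (o :: historyAt R n ω)) ∂μ := fun o =>
      (lintegral_const_mul _ (hmg (fun h => ENNReal.ofReal (potential p π (o :: h))) n)).symm
    simp only [hmul]
    rw [← lintegral_finsetSum _ fun o _ =>
        (hmg (fun h => ENNReal.ofReal (potential p π (o :: h))) n).const_mul _,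
      ← lintegral_add_left (hmg (fun h => if AllSatisfied π h then 0 else 1) n)]
    refine lintegral_mono fun ω => ?_
    refine le_trans (le_of_eq ?_)
      (ENNReal.ofReal_le_ofReal (potential_drift hp0 hp1 hπ (historyAt R n ω)))
    have hnn : ∀ o ∈ Finset.univ, 0 ≤ outcomeProb p o * potential p π (o :: historyAt R n ω) :=
      fun o _ => mul_nonneg (outcomeProb_nonneg hp0 hp1.le o) (potential_nonneg hp0 hp1)
    rw [ENNReal.ofReal_add (by split_ifs <;> simp) (Finset.sum_nonneg hnn),
      ENNReal.ofReal_sum_of_nonneg hnn]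
    congr 1
    · split_ifs <;> simp
    · exact Finset.sum_congr rfl fun o _ =>
        (ENNReal.ofReal_mul (outcomeProb_nonneg hp0 hp1.le o)).symm

theorem expectedTime_le_potential (hp0 : 0 ≤ p) (hp1 : p < 1)
    (hmeas : ∀ t i, Measurable (R t i))
    (hindep : iIndepFun (fun x : ℕ × Fin 3 => R x.1 x.2) μ)
    (hbern : ∀ t i, μ {ω | R t i ω = true} = ENNReal.ofReal (1 - p))
    {π : Policy k} (hπ : IsGreedy π) :
    expectedTime μ R π ≤ ENNReal.ofReal (potential p π []) := by
  classical
  refine (lintegral_mono fun ω =>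
    iInf_le_tsum_not fun m => AllSatisfied π (historyAt R m ω)).trans ?_
  rw [lintegral_tsum fun m => (measurable_comp_historyAt hmeas m
    fun h => if AllSatisfied π h then 0 else 1).aemeasurable]
  exact ENNReal.tsum_le_of_sum_range_le fun n => le_self_add.trans
    (sum_lintegral_add_potential_le hp0 hp1 hmeas hindep hbern hπ n)

/-- Every client `i` has received `a i` transmissions in the history. -/
def Served (a : Fin 3 → ℕ) (h : List Outcome) : Prop :=
  ∀ i, a i ≤ h.countP fun o => o i

theorem served_cons (a : Fin 3 → ℕ) (o : Outcome) (h : List Outcome) :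
    Served a (o :: h) ↔ Served (serve a o) h := by
  refine forall_congr' fun i => ?_
  cases ho : o i <;> simp [serve, ho]

theorem receptions_eq_countP (r : ℕ → Outcome) (i : Fin 3) (m : ℕ) :
    receptions r i m = (history r m).countP fun o => o i := by
  induction m with
  | zero => rfl
  | succ m ih =>
    rw [history, List.countP_cons, ← ih, receptions, receptions, Finset.range_add_one,
      Finset.filter_insert]
    split_ifs with h
    · rw [Finset.card_insert_of_notMem (by simp)]
    · rfl

theorem served_history_mono (a : Fin 3 → ℕ) (r : ℕ → Outcome) :
    Monotone fun m => Served a (history r m) :=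
  monotone_nat_of_le_succ fun m h i => (h i).trans (by simp [history, List.countP_cons])

open Classical in
-- Both sides satisfy the same recursion in m, by `served_cons` and `servedProb_succ`.
theorem lintegral_served (hp0 : 0 ≤ p) (hp1 : p ≤ 1) (hmeas : ∀ t i, Measurable (R t i))
    (hindep : iIndepFun (fun x : ℕ × Fin 3 => R x.1 x.2) μ)
    (hbern : ∀ t i, μ {ω | R t i ω = true} = ENNReal.ofReal (1 - p)) (m : ℕ)
    (a : Fin 3 → ℕ) :
    ∫⁻ ω, (if Served a (historyAt R m ω) then 0 else 1) ∂μ =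
      ENNReal.ofReal (1 - servedProb p a m) := by
  induction m generalizing a with
  | zero =>
    have : Served a [] ↔ a = 0 := by simp [Served, funext_iff]
    simp only [historyAt, history, this, servedProb_zero]
    split_ifs <;> simp
  | succ m ih =>
    rw [lintegral_historyAt_succ hp0 hp1 hmeas hindep hbern m
      fun h => if Served a h then 0 else 1]
    simp only [served_cons, ih]
    have hnn : ∀ o, 0 ≤ 1 - servedProb p (serve a o) m := fun o =>
      sub_nonneg.2 (servedProb_le_one hp0 hp1 _ _)
    simp only [← ENNReal.ofReal_mul (outcomeProb_nonneg hp0 hp1 _)]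
    rw [← ENNReal.ofReal_sum_of_nonneg fun o _ =>
      mul_nonneg (outcomeProb_nonneg hp0 hp1 o) (hnn o)]
    simp only [servedProb_succ, mul_sub, Finset.sum_sub_distrib, mul_one, sum_outcomeProb]

theorem expectedEll_eq_waitTime (hp0 : 0 ≤ p) (hp1 : p < 1) (hmeas : ∀ t i, Measurable (R t i))
    (hindep : iIndepFun (fun x : ℕ × Fin 3 => R x.1 x.2) μ)
    (hbern : ∀ t i, μ {ω | R t i ω = true} = ENNReal.ofReal (1 - p)) :
    expectedEll μ R k = ENNReal.ofReal (waitTime p ![k, k, k + 1]) := by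
  classical
  have hell : ∀ r, ell k r = ∑' m, if Served ![k, k, k + 1] (history r m) then 0 else 1 :=
    fun r => by
      rw [← iInf_eq_tsum_not (served_history_mono _ r)]
      simp [ell, Served, Fin.forall_fin_succ, receptions_eq_countP]
  simp only [expectedEll, hell]
  change ∫⁻ ω, ∑' m, (if Served ![k, k, k + 1] (historyAt R m ω) then 0 else 1) ∂μ = _
  rw [lintegral_tsum fun m => (measurable_comp_historyAt hmeas m
    fun h => if Served ![k, k, k + 1] h then 0 else 1).aemeasurable, waitTime,
    ENNReal.ofReal_tsum_of_nonneg
      (fun m => sub_nonneg.2 (servedProb_le_one hp0 hp1.le _ m))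
      (summable_one_sub_servedProb hp0 hp1 _)]
  exact tsum_congr fun m => lintegral_served hp0 hp1.le hmeas hindep hbern m _

theorem expectedTime_le_expectedEll (hp0 : 0 ≤ p) (hp1 : p < 1)
    (hmeas : ∀ t i, Measurable (R t i))
    (hindep : iIndepFun (fun x : ℕ × Fin 3 => R x.1 x.2) μ)
    (hbern : ∀ t i, μ {ω | R t i ω = true} = ENNReal.ofReal (1 - p))
    {π : Policy k} (hπ : IsGreedy π) :
    expectedTime μ R π ≤ expectedEll μ R k := by
  rw [expectedEll_eq_waitTime hp0 hp1 hmeas hindep hbern]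
  refine (expectedTime_le_potential hp0 hp1 hmeas hindep hbern hπ).trans
    (ENNReal.ofReal_le_ofReal ((potential_le hp0 hp1 π []).trans (waitTime_mono hp0 hp1 ?_)))
  intro i
  fin_cases i <;> simp [deficit]

end Expectation

theorem servedProb_vec (k : ℕ) (p : ℝ) (m : ℕ) :
    servedProb p ![k, k, k + 1] m = D₁ k p m ^ 2 * D₂ k p m := by
  simp [servedProb, Fin.prod_univ_three, D₂_eq_D₁, sq]

end Multicast

end

theorem mainTheorem2 {Ω : Type*} [MeasurableSpace Ω] (μ : Measure Ω) [IsProbabilityMeasure μ]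
    (k : ℕ) (p : ℝ) (hp0 : 0 ≤ p) (hp1 : p < 1)
    (R : ℕ → Fin 3 → Ω → Bool)
    (hmeas : ∀ t i, Measurable (R t i))
    (hindep : iIndepFun (fun x : ℕ × Fin 3 => R x.1 x.2) μ)
    (hbern : ∀ t i, μ {ω | R t i ω = true} = ENNReal.ofReal (1 - p)) :
    Multicast.minExpectedTime μ R k ≤ Multicast.expectedEll μ R k ∧
    (∀ π : Multicast.Policy k, Multicast.IsGreedy π →
      Multicast.expectedTime μ R π ≤ Multicast.expectedEll μ R k) ∧
    Summable (fun m : ℕ => 1 - Multicast.D₁ k p m ^ 2 * Multicast.D₂ k p m) ∧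
    Multicast.expectedEll μ R k =
      ENNReal.ofReal (∑' m : ℕ, (1 - Multicast.D₁ k p m ^ 2 * Multicast.D₂ k p m)) ∧
    ∑' m : ℕ, (1 - Multicast.D₁ k p m ^ 2 * Multicast.D₂ k p m) =
      (k : ℝ) + 1 + ∑' j : ℕ, (1 - Multicast.D₁ k p (k + 1 + j) ^ 2 *
        Multicast.D₂ k p (k + 1 + j)) := by
  have hgreedy : ∀ π : Multicast.Policy k, Multicast.IsGreedy π →
      Multicast.expectedTime μ R π ≤ Multicast.expectedEll μ R k := fun π hπ =>
    Multicast.expectedTime_le_expectedEll hp0 hp1 hmeas hindep hbern hπ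
  have hsum := Multicast.summable_one_sub_servedProb hp0 hp1 ![k, k, k + 1]
  simp only [Multicast.servedProb_vec] at hsum
  obtain ⟨π, hπ⟩ := Multicast.exists_isGreedy k
  refine ⟨(iInf_le _ π).trans (hgreedy π hπ), hgreedy, hsum, ?_, ?_⟩
  · rw [Multicast.expectedEll_eq_waitTime hp0 hp1 hmeas hindep hbern, Multicast.waitTime]
    simp only [Multicast.servedProb_vec]
  -- For m ≤ k the tail `D₂` is an empty sum, so the first k + 1 terms all equal 1.
  · have h1 : ∀ m ∈ Finset.range (k + 1),
        1 - Multicast.D₁ k p m ^ 2 * Multicast.D₂ k p m = 1 := fun m hm => by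
      rw [Multicast.D₂_eq_D₁, Multicast.D₁_eq_zero (Finset.mem_range.1 hm), mul_zero, sub_zero]
    rw [← hsum.sum_add_tsum_nat_add (k + 1), Finset.sum_congr rfl h1]
    simp [add_comm]
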